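/- Let $X,Y,Y^*$ be random variables on a common probability space, where $X$ (the input) takes values in an arbitrary measurable space $\mathcal X$, and $Y$ (the observed label) and $Y^*$ (the true class) take values in finite or countable sets. Write $p(y)=P(Y=y)$, $p(y^*)=P(Y^*=y^*)$ and $p(y|y^*)=P(Y=y\mid Y^*=y^*)$. For a representation $Z$ of $X$ given by a conditional distribution $p(z|x)$, with $Z$ and $Y$ conditionally independent given $X$, and $I$ denoting mutual information, put $\mathrm{IB}_\beta[p(z|x)]=I(X;Z)-\beta\, I(Y;Z)$. The pair $(X,Y)$ is called $\mathrm{IB}_\beta$-learnable if there is some $p(z|x)$, with $I(X;Z)$ and $I(Y;Z)$ finite, whose value $\mathrm{IB}_\beta[p(z|x)]$ is strictly smaller than the value at the trivial representations $p(z|x)=p(z)$, where $Z$ is independent of $X$. Suppose that (i) the true classes do not overlap in input space: there are pairwise disjoint measurable sets $S_{y^*}\subset\mathcal X$ with $X\in S_{Y^*}$ almost surely; (ii) the label noise is class-conditional: $p(y|x,y^*)=p(y|y^*)$ for all $y$ and almost all $(x,y^*)$; (iii) $X$ and $Y$ are not independent. Then, for every real $\beta$ with $$\beta>\inf_{y^*}\frac{\frac1{p(y^*)}-1}{\sum_y\frac{p(y|y^*)^2}{p(y)}-1},$$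 $(X,Y)$ is $\mathrm{IB}_\beta$-learnable. Here the infimum is over the true classes $y^*$ with $p(y^*)>0$ for which the denominator is nonzero, and the sum is over the labels $y$ with $p(y)>0$. -/

import Mathlib

open MeasureTheory ProbabilityTheory
open scoped ENNReal

noncomputable section

namespace IB

/-- Mutual information (in nats) of a pair of random variables with joint law `ρ`:
the Kullback-Leibler divergence of the joint law from the product of its marginals. -/
def mutualInfo {α β : Type*} [MeasurableSpace α] [MeasurableSpace β]
    (ρ : Measure (α × β)) : ℝ≥0∞ :=
  InformationTheory.klDiv ρ (ρ.fst.prod ρ.snd)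

/-- Joint law of `((X, Y), Z)` when `(X, Y)` has law `P` and `Z` is drawn from `p(z|x) = κ x`,
independently of `Y` given `X` (the Markov chain `Z ← X ↔ Y`). -/
def jointLaw {𝒳 𝒴 𝒵 : Type*} [MeasurableSpace 𝒳] [MeasurableSpace 𝒴] [MeasurableSpace 𝒵]
    (P : Measure (𝒳 × 𝒴)) (κ : Kernel 𝒳 𝒵) : Measure ((𝒳 × 𝒴) × 𝒵) :=
  P ⊗ₘ Kernel.prodMkRight 𝒴 κ

/-- `I(X;Z)`. -/
def infoXZ {𝒳 𝒴 𝒵 : Type*} [MeasurableSpace 𝒳] [MeasurableSpace 𝒴] [MeasurableSpace 𝒵]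
    (P : Measure (𝒳 × 𝒴)) (κ : Kernel 𝒳 𝒵) : ℝ≥0∞ :=
  mutualInfo ((jointLaw P κ).map (fun q => (q.1.1, q.2)))

/-- `I(Y;Z)`. -/
def infoYZ {𝒳 𝒴 𝒵 : Type*} [MeasurableSpace 𝒳] [MeasurableSpace 𝒴] [MeasurableSpace 𝒵]
    (P : Measure (𝒳 × 𝒴)) (κ : Kernel 𝒳 𝒵) : ℝ≥0∞ :=
  mutualInfo ((jointLaw P κ).map (fun q => (q.1.2, q.2)))

/-- The information bottleneck objective `I(X;Z) - β I(Y;Z)` of the representation `κ`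
(meaningful when both informations are finite). -/
def objective {𝒳 𝒴 𝒵 : Type*} [MeasurableSpace 𝒳] [MeasurableSpace 𝒴] [MeasurableSpace 𝒵]
    (β : ℝ) (P : Measure (𝒳 × 𝒴)) (κ : Kernel 𝒳 𝒵) : ℝ :=
  (infoXZ P κ).toReal - β * (infoYZ P κ).toReal

/-- `(X, Y)` with joint law `P` is `IB_β`-learnable: some representation `p(z|x) = κ x`, for which
the objective is well defined, has a strictly smaller objective than the trivial
representations `p(z|x) = p(z)`. (A standard Borel space embeds in `ℝ`, so that taking
`𝒵` in `Type` is no restriction.) -/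
def Learnable {𝒳 𝒴 : Type*} [MeasurableSpace 𝒳] [MeasurableSpace 𝒴]
    (β : ℝ) (P : Measure (𝒳 × 𝒴)) : Prop :=
  ∃ (𝒵 : Type) (_ : MeasurableSpace 𝒵) (_ : StandardBorelSpace 𝒵)
    (κ : Kernel 𝒳 𝒵) (_ : IsMarkovKernel κ),
    infoXZ P κ ≠ ∞ ∧ infoYZ P κ ≠ ∞ ∧
    ∀ ν : Measure 𝒵, IsProbabilityMeasure ν → objective β P κ < objective β P (Kernel.const 𝒳 ν)

/-- The true classes occupy disjoint parts of the input space. -/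
def NoClassOverlap {Ω 𝒳 𝒞 : Type*} [MeasurableSpace Ω] [MeasurableSpace 𝒳]
    (μ : Measure Ω) (X : Ω → 𝒳) (C : Ω → 𝒞) : Prop :=
  ∃ S : 𝒞 → Set 𝒳, (∀ c, MeasurableSet (S c)) ∧ (∀ c d, c ≠ d → Disjoint (S c) (S d)) ∧
    ∀ᵐ ω ∂μ, X ω ∈ S (C ω)

/-- The noise rate `p(y|y*)` at `y* = c`. -/
def noiseRate {Ω 𝒞 𝒴 : Type*} [MeasurableSpace Ω]
    (μ : Measure Ω) (C : Ω → 𝒞) (Y : Ω → 𝒴) (c : 𝒞) (y : 𝒴) : ℝ :=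
  (μ[|C ⁻¹' {c}]).real (Y ⁻¹' {y})

/-- Class-conditional label noise: `p(y|x,y*) = p(y|y*)` for every `y` and almost every
`(x, y*)`, where `p(y|x,y*)` is the regular conditional distribution. -/
def ClassConditionalNoise {Ω 𝒳 𝒞 𝒴 : Type*} [MeasurableSpace Ω] [MeasurableSpace 𝒳]
    [MeasurableSpace 𝒞] [MeasurableSpace 𝒴] [StandardBorelSpace 𝒴] [Nonempty 𝒴]
    (μ : Measure Ω) [IsFiniteMeasure μ] (X : Ω → 𝒳) (C : Ω → 𝒞) (Y : Ω → 𝒴) : Prop :=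
  ∀ᵐ p ∂(μ.map (fun ω => (X ω, C ω))), ∀ y : 𝒴,
    (condDistrib Y (fun ω => (X ω, C ω)) μ p).real {y} = noiseRate μ C Y p.2 y

/-- `∑_y p(y|y*)² / p(y) - 1` at `y* = c`; the series converges when `p(y*) > 0`, because
`p(y*) p(y|y*) ≤ p(y)`, and a label with `p(y) = 0` contributes `0`. -/
def chiSq {Ω 𝒞 𝒴 : Type*} [MeasurableSpace Ω]
    (μ : Measure Ω) (C : Ω → 𝒞) (Y : Ω → 𝒴) (c : 𝒞) : ℝ :=
  (∑' y, noiseRate μ C Y c y ^ 2 / μ.real (Y ⁻¹' {y})) - 1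

open scoped Classical in
/-- `(1/p(y*) - 1) / (∑_y p(y|y*)² / p(y) - 1)` at `y* = c`. It is `+∞`, so that it does not
contribute to an infimum, when `p(y*) = 0` or when the denominator vanishes. -/
def classRatio {Ω 𝒞 𝒴 : Type*} [MeasurableSpace Ω]
    (μ : Measure Ω) (C : Ω → 𝒞) (Y : Ω → 𝒴) (c : 𝒞) : EReal :=
  if μ.real (C ⁻¹' {c}) = 0 ∨ chiSq μ C Y c = 0 then ⊤
  else (((1 / μ.real (C ⁻¹' {c}) - 1) / chiSq μ C Y c : ℝ) : EReal)

end IB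

end

namespace IB

open InformationTheory Set

/-! ### Quadratic bounds for the relative entropy of a nearly fair coin. -/

section KLFun

/-! A weakly informative binary `Z` already suffices. For a bounded centred `f`, let `Z` be a sign
with conditional mean `ε f(X)`. Given `Y`, it is a sign with mean `ε g(Y)`, where `g(Y) = E[f(X) |
Y]`. To leading order in `ε` the informations are `I(X;Z) ≈ ε² Var f(X) / 2` and `I(Y;Z) ≈ ε² Var
g(Y) / 2`, so `Var f(X) < β Var g(Y)` makes the objective negative, while trivial representations
give `0` (`learnable_of_variance_lt`).

A class `c` whose ratio lies below `β` supplies `f = 1_{S c} - p(c)`. As the sets `S` are disjoint,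
`X ∈ S c` is almost surely the event that the true class is `c`. Hence `Var f(X) = p(c)(1 - p(c))`,
`g(y) = P(Y* = c | Y = y) - p(c)`, and `Var g(Y) = p(c)² (∑_y p(y|c)²/p(y) - 1)` by
`integral_classLabelLaw_div_sub_sq`. The quotient of the variances is the ratio of the class `c`. -/

theorem hasDerivAt_klFun_one_add_add_klFun_one_sub {t : ℝ} (h₁ : 1 + t ≠ 0) (h₂ : 1 - t ≠ 0) :
    HasDerivAt (fun t : ℝ => klFun (1 + t) + klFun (1 - t))
      (Real.log (1 + t) - Real.log (1 - t)) t := by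
  have e₁ := (hasDerivAt_klFun h₁).comp t ((hasDerivAt_id t).const_add 1)
  have e₂ := (hasDerivAt_klFun h₂).comp t ((hasDerivAt_id t).const_sub 1)
  exact (e₁.add e₂).congr_deriv (by ring)

theorem two_mul_le_log_one_add_sub_log_one_sub {t : ℝ} (h₀ : 0 ≤ t) (h₁ : t < 1) :
    2 * t ≤ Real.log (1 + t) - Real.log (1 - t) := by
  have h : 0 < 1 - t := by linarith
  have e : 1 + 2 * t / (1 - t) = (1 + t) / (1 - t) := by field_simp; ring
  -- The bound `2x/(x+2) ≤ log (1+x)` becomes exactly `2t` at `x = 2t/(1-t)`.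
  have k := Real.le_log_one_add_of_nonneg (x := 2 * t / (1 - t)) (by positivity)
  rw [e, Real.log_div (by linarith) h.ne'] at k
  refine le_trans (le_of_eq ?_) k
  field_simp
  ring

theorem log_one_add_sub_log_one_sub_le {t : ℝ} (h₀ : 0 ≤ t) (h₁ : t ≤ 1 / 2) :
    Real.log (1 + t) - Real.log (1 - t) ≤ 2 * t + 8 * t ^ 3 := by
  have h : 0 < 1 - t := by linarith
  have h' : 0 < 1 + t := by linarith
  rw [← Real.log_div h'.ne' h.ne']
  have hx : 0 < (1 + t) / (1 - t) := by positivity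
  -- Here `u ≤ sinh u` is used at `u = log ((1+t)/(1-t))`, where `sinh u = 2t/(1-t²)`.
  have k : Real.log ((1 + t) / (1 - t)) ≤ Real.sinh (Real.log ((1 + t) / (1 - t))) :=
    Real.self_le_sinh_iff.2 (Real.log_nonneg ((one_le_div h).2 (by linarith)))
  rw [Real.sinh_log hx] at k
  have e : ((1 + t) / (1 - t) - ((1 + t) / (1 - t))⁻¹) / 2 = 2 * t / ((1 - t) * (1 + t)) := by
    field_simp
    ring
  refine k.trans ?_
  rw [e, div_le_iff₀ (by positivity)]
  have : 0 ≤ t ^ 3 * (3 - 4 * t ^ 2) := mul_nonneg (by positivity) (by nlinarith)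
  nlinarith

theorem klFun_one_add_add_klFun_one_sub_abs (t : ℝ) :
    klFun (1 + |t|) + klFun (1 - |t|) = klFun (1 + t) + klFun (1 - t) := by
  rcases abs_choice t with h | h <;> rw [h]
  rw [sub_neg_eq_add, ← sub_eq_add_neg, add_comm]

theorem continuous_klFun_one_add_add_klFun_one_sub :
    Continuous fun t : ℝ => klFun (1 + t) + klFun (1 - t) :=
  (continuous_klFun.comp (by fun_prop)).add (continuous_klFun.comp (by fun_prop))

/-- Both sides are even and vanish at `0`, so comparing derivatives on `[0, 1/2]` is enough. The
left side of the logarithmic estimate and its cubic error give this bound and the next one. -/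
theorem sq_le_klFun_one_add_add_klFun_one_sub {t : ℝ} (ht : |t| ≤ 1 / 2) :
    t ^ 2 ≤ klFun (1 + t) + klFun (1 - t) := by
  have hmono : MonotoneOn (fun t : ℝ => klFun (1 + t) + klFun (1 - t) - t ^ 2)
      (Icc 0 (1 / 2)) := by
    refine monotoneOn_of_hasDerivWithinAt_nonneg (convex_Icc _ _)
      (f' := fun t => Real.log (1 + t) - Real.log (1 - t) - 2 * t)
      (continuous_klFun_one_add_add_klFun_one_sub.sub (by fun_prop)).continuousOn ?_ ?_
    · intro x hx
      rw [interior_Icc] at hx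
      refine (((hasDerivAt_klFun_one_add_add_klFun_one_sub (by linarith [hx.1])
        (by linarith [hx.2])).sub (hasDerivAt_pow 2 x)).congr_deriv ?_).hasDerivWithinAt
      simp
    · intro x hx
      rw [interior_Icc] at hx
      linarith [two_mul_le_log_one_add_sub_log_one_sub hx.1.le (by linarith [hx.2])]
  have := hmono (a := 0) (b := |t|) (by simp) ⟨abs_nonneg t, ht⟩ (abs_nonneg t)
  simp only [klFun_one_add_add_klFun_one_sub_abs, sq_abs] at this
  simpa [klFun_one] using this

theorem klFun_one_add_add_klFun_one_sub_le {t : ℝ} (ht : |t| ≤ 1 / 2) :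
    klFun (1 + t) + klFun (1 - t) ≤ t ^ 2 + 2 * t ^ 4 := by
  have hmono : MonotoneOn (fun t : ℝ => t ^ 2 + 2 * t ^ 4 - (klFun (1 + t) + klFun (1 - t)))
      (Icc 0 (1 / 2)) := by
    refine monotoneOn_of_hasDerivWithinAt_nonneg (convex_Icc _ _)
      (f' := fun t => 2 * t + 8 * t ^ 3 - (Real.log (1 + t) - Real.log (1 - t)))
      (Continuous.sub (by fun_prop) continuous_klFun_one_add_add_klFun_one_sub).continuousOn ?_ ?_
    · intro x hx
      rw [interior_Icc] at hx
      refine ((((hasDerivAt_pow 2 x).add ((hasDerivAt_pow 4 x).const_mul 2)).sub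
        (hasDerivAt_klFun_one_add_add_klFun_one_sub (by linarith [hx.1])
          (by linarith [hx.2]))).congr_deriv ?_).hasDerivWithinAt
      norm_num
      ring
    · intro x hx
      rw [interior_Icc] at hx
      linarith [log_one_add_sub_log_one_sub_le hx.1.le hx.2.le]
  have := hmono (a := 0) (b := |t|) (by simp) ⟨abs_nonneg t, ht⟩ (abs_nonneg t)
  have e : |t| ^ 4 = t ^ 4 := (show Even 4 by decide).pow_abs t
  simp only [klFun_one_add_add_klFun_one_sub_abs, sq_abs, e] at this
  simpa [klFun_one] using this

end KLFun

/-! ### Coins with a random bias and their mutual information. -/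

section Coin

/-- The uniform probability measure on `Bool`. -/
noncomputable def fairCoin : Measure Bool := (2⁻¹ : ℝ≥0∞) • Measure.count

/-- The sign `±1` of a Boolean. -/
def sign (b : Bool) : ℝ := cond b 1 (-1)

theorem lintegral_fairCoin (f : Bool → ℝ≥0∞) :
    ∫⁻ b, f b ∂fairCoin = 2⁻¹ * (f true + f false) := by
  simp [fairCoin, lintegral_count]

instance : IsProbabilityMeasure fairCoin :=
  ⟨by
    rw [← lintegral_one, lintegral_fairCoin, one_add_one_eq_two]
    exact ENNReal.inv_mul_cancel (by simp) (by simp)⟩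

theorem lintegral_fairCoin_ofReal {f : Bool → ℝ} (hf : ∀ b, 0 ≤ f b) :
    ∫⁻ b, ENNReal.ofReal (f b) ∂fairCoin = ENNReal.ofReal ((f true + f false) / 2) := by
  rw [lintegral_fairCoin, ← ENNReal.ofReal_add (hf _) (hf _), div_eq_inv_mul,
    ENNReal.ofReal_mul (by norm_num), ENNReal.ofReal_inv_of_pos (by norm_num)]
  simp

theorem abs_sign_mul (b : Bool) (t : ℝ) : |sign b * t| = |t| := by
  cases b <;> simp [sign]

theorem one_add_sign_mul_nonneg {t : ℝ} (ht : |t| ≤ 1 / 2) (b : Bool) : 0 ≤ 1 + sign b * t := by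
  have := abs_sign_mul b t ▸ neg_abs_le (sign b * t)
  linarith

theorem lintegral_fairCoin_one_add_sign_mul {t : ℝ} (ht : |t| ≤ 1 / 2) :
    ∫⁻ b, ENNReal.ofReal (1 + sign b * t) ∂fairCoin = 1 := by
  rw [lintegral_fairCoin_ofReal (one_add_sign_mul_nonneg ht)]
  simp only [sign, cond_true, cond_false]
  ring_nf
  simp

variable {α : Type*} [MeasurableSpace α]

/-- The measure with density `1 ± m(a)` with respect to `Q × fairCoin`: a coin flip whose bias,
given `a`, is `m a`. -/
noncomputable def biasedCoin (Q : Measure α) (m : α → ℝ) : Measure (α × Bool) :=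
  (Q.prod fairCoin).withDensity fun w => ENNReal.ofReal (1 + sign w.2 * m w.1)

theorem measurable_one_add_sign_mul {m : α → ℝ} (hm : Measurable m) :
    Measurable fun w : α × Bool => ENNReal.ofReal (1 + sign w.2 * m w.1) := by
  have : Measurable sign := measurable_of_countable _
  fun_prop

theorem biasedCoin_prod (Q : Measure α) [SFinite Q] {m : α → ℝ} (hm : Measurable m)
    (A : Set α) (B : Set Bool) (hA : MeasurableSet A) :
    biasedCoin Q m (A ×ˢ B)
      = ∫⁻ b in B, ∫⁻ a in A, ENNReal.ofReal (1 + sign b * m a) ∂Q ∂fairCoin := by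
  rw [biasedCoin, withDensity_apply _ (hA.prod (MeasurableSet.of_discrete)),
    setLIntegral_prod_symm _ (measurable_one_add_sign_mul hm).aemeasurable]

theorem setLIntegral_one_add_sign_mul {Q : Measure α} [IsFiniteMeasure Q] {m : α → ℝ}
    (hm : Measurable m) (hb : ∀ a, |m a| ≤ 1 / 2) (A : Set α) (b : Bool) :
    ∫⁻ a in A, ENNReal.ofReal (1 + sign b * m a) ∂Q
      = ENNReal.ofReal (Q.real A + sign b * ∫ a in A, m a ∂Q) := by
  have hi : Integrable m (Q.restrict A) :=
    Integrable.of_bound hm.aestronglyMeasurable (1 / 2) (ae_of_all _ hb)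
  have hi' : Integrable (fun a => 1 + sign b * m a) (Q.restrict A) :=
    (integrable_const 1).add (hi.const_mul _)
  rw [← ofReal_integral_eq_lintegral_ofReal hi'
    (ae_of_all _ fun a => one_add_sign_mul_nonneg (hb a) b),
    integral_add (integrable_const 1) (hi.const_mul _), integral_const_mul]
  simp

theorem fst_biasedCoin (Q : Measure α) [SFinite Q] {m : α → ℝ} (hm : Measurable m)
    (hb : ∀ a, |m a| ≤ 1 / 2) : (biasedCoin Q m).fst = Q := by
  ext A hA
  rw [Measure.fst_apply hA, ← prod_univ, biasedCoin, withDensity_apply _ (hA.prod .univ),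
    setLIntegral_prod _ (measurable_one_add_sign_mul hm).aemeasurable]
  simp_rw [Measure.restrict_univ, lintegral_fairCoin_one_add_sign_mul (hb _)]
  simp

theorem snd_biasedCoin (Q : Measure α) [IsProbabilityMeasure Q] {m : α → ℝ} (hm : Measurable m)
    (hb : ∀ a, |m a| ≤ 1 / 2) (h₀ : ∫ a, m a ∂Q = 0) : (biasedCoin Q m).snd = fairCoin := by
  ext B hB
  rw [Measure.snd_apply hB, ← univ_prod, biasedCoin_prod Q hm _ _ .univ]
  simp_rw [setLIntegral_one_add_sign_mul hm hb, Measure.restrict_univ, h₀]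
  simp only [probReal_univ, mul_zero, add_zero, ENNReal.ofReal_one, lintegral_one,
    Measure.restrict_apply_univ]

theorem integrable_klFun_one_add_add_klFun_one_sub {Q : Measure α} [IsFiniteMeasure Q]
    {m : α → ℝ} (hm : Measurable m) (hb : ∀ a, |m a| ≤ 1 / 2) :
    Integrable (fun a => (klFun (1 + m a) + klFun (1 - m a)) / 2) Q := by
  refine Integrable.of_bound ((continuous_klFun_one_add_add_klFun_one_sub.measurable.comp
    hm).div_const 2).aestronglyMeasurable 1 (ae_of_all _ fun a => ?_)
  have h₁ := klFun_one_add_add_klFun_one_sub_le (hb a)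
  have h₂ : m a ^ 2 ≤ 1 / 4 := by
    have := pow_le_pow_left₀ (abs_nonneg _) (hb a) 2
    rw [sq_abs] at this
    linarith
  have h₃ := sq_le_klFun_one_add_add_klFun_one_sub (hb a)
  rw [Real.norm_of_nonneg (by nlinarith [sq_nonneg (m a)])]
  nlinarith [sq_nonneg (m a)]

/-- Since `m` is centred, the marginals are `Q` and the fair coin, so `1 ± m` is the density against
the product of the marginals; averaging `klFun` of it over the sign gives the integrand. -/
theorem mutualInfo_biasedCoin (Q : Measure α) [IsProbabilityMeasure Q] {m : α → ℝ}
    (hm : Measurable m) (hb : ∀ a, |m a| ≤ 1 / 2) (h₀ : ∫ a, m a ∂Q = 0) :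
    mutualInfo (biasedCoin Q m)
      = ENNReal.ofReal (∫ a, (klFun (1 + m a) + klFun (1 - m a)) / 2 ∂Q) := by
  have hmeas := measurable_one_add_sign_mul hm
  have hnn : ∀ a b, 0 ≤ klFun (1 + sign b * m a) := fun a b =>
    klFun_nonneg (one_add_sign_mul_nonneg (hb a) b)
  have hfin : IsFiniteMeasure (biasedCoin Q m) := by
    constructor
    rw [← Measure.fst_univ, fst_biasedCoin Q hm hb]
    exact measure_lt_top _ _
  have hac : biasedCoin Q m ≪ Q.prod fairCoin := withDensity_absolutelyContinuous _ _
  have hrn : ∀ᵐ w ∂Q.prod fairCoin,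
      ENNReal.ofReal (klFun ((biasedCoin Q m).rnDeriv (Q.prod fairCoin) w).toReal)
        = ENNReal.ofReal (klFun (1 + sign w.2 * m w.1)) := by
    filter_upwards [Measure.rnDeriv_withDensity (Q.prod fairCoin) hmeas] with w hw
    rw [biasedCoin, hw, ENNReal.toReal_ofReal (one_add_sign_mul_nonneg (hb _) _)]
  have hsign : Measurable sign := measurable_of_countable _
  have hkl : Measurable fun w : α × Bool => ENNReal.ofReal (klFun (1 + sign w.2 * m w.1)) :=
    (measurable_klFun.comp (by fun_prop)).ennreal_ofReal
  rw [mutualInfo, fst_biasedCoin Q hm hb, snd_biasedCoin Q hm hb h₀,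
    klDiv_eq_lintegral_klFun_of_ac hac, lintegral_congr_ae hrn,
    lintegral_prod _ hkl.aemeasurable]
  simp_rw [lintegral_fairCoin_ofReal (hnn _)]
  have hle : ∀ a, 0 ≤ (klFun (1 + m a) + klFun (1 - m a)) / 2 := fun a => by
    have := sq_le_klFun_one_add_add_klFun_one_sub (hb a)
    have := sq_nonneg (m a)
    linarith
  rw [ofReal_integral_eq_lintegral_ofReal _ (ae_of_all _ hle)]
  · simp [sign, sub_eq_add_neg]
  · exact integrable_klFun_one_add_add_klFun_one_sub hm hb

end Coin

/-! ### Comparison of this information with half the variance of the bias. -/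

section Coin

variable {α : Type*} [MeasurableSpace α]

theorem integrable_sq_of_abs_le {Q : Measure α} [IsFiniteMeasure Q] {m : α → ℝ}
    (hm : Measurable m) {δ : ℝ} (hb : ∀ a, |m a| ≤ δ) : Integrable (fun a => m a ^ 2) Q :=
  Integrable.of_bound (hm.pow_const 2).aestronglyMeasurable (δ ^ 2) (ae_of_all _ fun a => by
    rw [norm_pow, Real.norm_eq_abs]
    exact pow_le_pow_left₀ (abs_nonneg _) (hb a) 2)

theorem toReal_mutualInfo_biasedCoin (Q : Measure α) [IsProbabilityMeasure Q] {m : α → ℝ}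
    (hm : Measurable m) (hb : ∀ a, |m a| ≤ 1 / 2) (h₀ : ∫ a, m a ∂Q = 0) :
    (mutualInfo (biasedCoin Q m)).toReal
      = ∫ a, (klFun (1 + m a) + klFun (1 - m a)) / 2 ∂Q := by
  rw [mutualInfo_biasedCoin Q hm hb h₀, ENNReal.toReal_ofReal]
  refine integral_nonneg fun a => ?_
  have := sq_le_klFun_one_add_add_klFun_one_sub (hb a)
  have := sq_nonneg (m a)
  simp only [Pi.zero_apply]
  linarith

theorem le_toReal_mutualInfo_biasedCoin (Q : Measure α) [IsProbabilityMeasure Q] {m : α → ℝ}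
    (hm : Measurable m) (hb : ∀ a, |m a| ≤ 1 / 2) (h₀ : ∫ a, m a ∂Q = 0) :
    (∫ a, m a ^ 2 ∂Q) / 2 ≤ (mutualInfo (biasedCoin Q m)).toReal := by
  rw [toReal_mutualInfo_biasedCoin Q hm hb h₀, ← integral_div]
  refine integral_mono ((integrable_sq_of_abs_le hm hb).div_const 2)
    (integrable_klFun_one_add_add_klFun_one_sub hm hb) fun a => ?_
  have := sq_le_klFun_one_add_add_klFun_one_sub (hb a)
  simp only
  linarith

theorem toReal_mutualInfo_biasedCoin_le (Q : Measure α) [IsProbabilityMeasure Q] {m : α → ℝ}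
    (hm : Measurable m) {δ : ℝ} (hδ : δ ≤ 1 / 2) (hb : ∀ a, |m a| ≤ δ) (h₀ : ∫ a, m a ∂Q = 0) :
    (mutualInfo (biasedCoin Q m)).toReal ≤ (1 / 2 + δ ^ 2) * ∫ a, m a ^ 2 ∂Q := by
  have hb' : ∀ a, |m a| ≤ 1 / 2 := fun a => (hb a).trans hδ
  rw [toReal_mutualInfo_biasedCoin Q hm hb' h₀, ← integral_const_mul]
  refine integral_mono (integrable_klFun_one_add_add_klFun_one_sub hm hb')
    ((integrable_sq_of_abs_le hm hb).const_mul _) fun a => ?_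
  have h₁ := klFun_one_add_add_klFun_one_sub_le (hb' a)
  have h₂ := pow_le_pow_left₀ (abs_nonneg _) (hb a) 2
  rw [sq_abs] at h₂
  have h₃ := mul_le_mul_of_nonneg_right h₂ (sq_nonneg (m a))
  simp only
  nlinarith

end Coin

/-! ### Coin-flip representations and the variance criterion. -/

section Representation

variable {𝒳 𝒴 𝒵 𝒲 : Type*} [MeasurableSpace 𝒳] [MeasurableSpace 𝒴] [MeasurableSpace 𝒵]
  [MeasurableSpace 𝒲]

/-- The representation of the input as a coin flip with bias `t x`. -/
noncomputable def coinKernel (t : 𝒳 → ℝ) : Kernel 𝒳 Bool :=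
  Kernel.withDensity (Kernel.const 𝒳 fairCoin) fun x b => ENNReal.ofReal (1 + sign b * t x)

theorem coinKernel_apply {t : 𝒳 → ℝ} (ht : Measurable t) (x : 𝒳) (B : Set Bool) :
    coinKernel t x B = ∫⁻ b in B, ENNReal.ofReal (1 + sign b * t x) ∂fairCoin := by
  rw [coinKernel, Kernel.withDensity_apply' _ (measurable_one_add_sign_mul ht),
    Kernel.const_apply]

theorem isMarkovKernel_coinKernel {t : 𝒳 → ℝ} (ht : Measurable t) (hb : ∀ x, |t x| ≤ 1 / 2) :
    IsMarkovKernel (coinKernel t) :=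
  ⟨fun x => ⟨by
    rw [coinKernel_apply ht, Measure.restrict_univ, lintegral_fairCoin_one_add_sign_mul (hb x)]⟩⟩

/-- Hypothesis `h` says that `m(W)` is the conditional expectation of `t(X)` given `W`. The coin's
density is affine in its bias, so forgetting everything but `W` averages the bias. Taking `W` to be
either coordinate yields both informations. -/
theorem map_jointLaw_coinKernel (P : Measure (𝒳 × 𝒴)) [IsFiniteMeasure P] {t : 𝒳 → ℝ}
    (ht : Measurable t) (htb : ∀ x, |t x| ≤ 1 / 2) {W : 𝒳 × 𝒴 → 𝒲} (hW : Measurable W)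
    {m : 𝒲 → ℝ} (hm : Measurable m) (hmb : ∀ w, |m w| ≤ 1 / 2)
    (h : ∀ A, MeasurableSet A → ∫ w in A, m w ∂(P.map W) = ∫ q in W ⁻¹' A, t q.1 ∂P) :
    (jointLaw P (coinKernel t)).map (fun q => (W q.1, q.2)) = biasedCoin (P.map W) m := by
  have := isMarkovKernel_coinKernel ht htb
  have hfin : IsFiniteMeasure (jointLaw P (coinKernel t)) := by
    unfold jointLaw
    infer_instance
  have hmap : Measurable fun q : (𝒳 × 𝒴) × Bool => (W q.1, q.2) := by fun_prop
  have ht' : Measurable fun q : 𝒳 × 𝒴 => t q.1 := by fun_prop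
  refine Measure.ext_prod fun {A B} hA hB => ?_
  have hpre : (fun q : (𝒳 × 𝒴) × Bool => (W q.1, q.2)) ⁻¹' (A ×ˢ B) = (W ⁻¹' A) ×ˢ B := rfl
  rw [Measure.map_apply hmap (hA.prod hB), hpre, jointLaw,
    Measure.compProd_apply_prod (hW hA) hB, biasedCoin_prod _ hm _ _ hA]
  simp_rw [Kernel.prodMkRight_apply, coinKernel_apply ht]
  rw [lintegral_lintegral_swap (measurable_one_add_sign_mul ht').aemeasurable]
  refine lintegral_congr fun b => ?_
  rw [setLIntegral_one_add_sign_mul ht' (fun q => htb q.1), setLIntegral_one_add_sign_mul hm hmb,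
    h A hA, map_measureReal_apply hW hA]

theorem mutualInfo_map_jointLaw_const (P : Measure (𝒳 × 𝒴)) [IsProbabilityMeasure P]
    (ν : Measure 𝒵) [IsProbabilityMeasure ν] {W : 𝒳 × 𝒴 → 𝒲} (hW : Measurable W) :
    mutualInfo ((jointLaw P (Kernel.const 𝒳 ν)).map (fun q => (W q.1, q.2))) = 0 := by
  have hP := Measure.isProbabilityMeasure_map (μ := P) hW.aemeasurable
  have e : (jointLaw P (Kernel.const 𝒳 ν)).map (fun q => (W q.1, q.2)) = (P.map W).prod ν := by
    have hk : Kernel.prodMkRight 𝒴 (Kernel.const 𝒳 ν) = Kernel.const (𝒳 × 𝒴) ν := rfl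
    rw [jointLaw, hk, Measure.compProd_const]
    conv_rhs => rw [← Measure.map_id (μ := ν), Measure.map_prod_map _ _ hW measurable_id]
    rfl
  rw [e, mutualInfo, Measure.fst_prod, Measure.snd_prod]
  exact klDiv_self _

theorem objective_const (β : ℝ) (P : Measure (𝒳 × 𝒴)) [IsProbabilityMeasure P]
    (ν : Measure 𝒵) [IsProbabilityMeasure ν] : objective β P (Kernel.const 𝒳 ν) = 0 := by
  have h₁ : infoXZ P (Kernel.const 𝒳 ν) = 0 := mutualInfo_map_jointLaw_const P ν measurable_fst
  have h₂ : infoYZ P (Kernel.const 𝒳 ν) = 0 := mutualInfo_map_jointLaw_const P ν measurable_snd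
  simp [objective, h₁, h₂]

/-- If a bounded centred function `f` of the input, with conditional expectation `g` given the
label, satisfies `Var f(X) < β Var g(Y)`, then the pair is learnable. -/
theorem learnable_of_variance_lt (P : Measure (𝒳 × 𝒴)) [IsProbabilityMeasure P] {β : ℝ}
    (hβ : 0 ≤ β) {f : 𝒳 → ℝ} (hf : Measurable f) (hfb : ∀ x, |f x| ≤ 1) {g : 𝒴 → ℝ}
    (hg : Measurable g) (hgb : ∀ y, |g y| ≤ 1) (h₀ : ∫ q, f q.1 ∂P = 0)
    (h : ∀ A, MeasurableSet A → ∫ y in A, g y ∂P.snd = ∫ q in Prod.snd ⁻¹' A, f q.1 ∂P)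
    (hlt : ∫ x, f x ^ 2 ∂P.fst < β * ∫ y, g y ^ 2 ∂P.snd) : Learnable β P := by
  set V := ∫ x, f x ^ 2 ∂P.fst with hV
  set U := ∫ y, g y ^ 2 ∂P.snd with hU
  -- The target is `(1 + 2ε²) V < β U`. As `V ≤ 1` and `2ε² ≤ ε` for `ε ≤ 1/2`, any such `ε` below
  -- the gap `β U - V` works.
  obtain ⟨ε, hε₀, hε₁, hε₂⟩ : ∃ ε : ℝ, 0 < ε ∧ ε ≤ 1 / 2 ∧ ε < β * U - V :=
    ⟨min (1 / 2) ((β * U - V) / 2), lt_min (by norm_num) (by linarith), min_le_left _ _,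
      (min_le_right _ _).trans_lt (by linarith)⟩
  have hV₁ : V ≤ 1 := by
    have : V ≤ ∫ _, (1 : ℝ) ∂P.fst := by
      refine integral_mono (integrable_sq_of_abs_le hf hfb) (integrable_const 1) fun x => ?_
      exact (sq_le_one_iff_abs_le_one _).2 (hfb x)
    simpa using this
  have hV₀ : 0 ≤ V := integral_nonneg fun x => sq_nonneg _
  have scale : ∀ r : ℝ, |r| ≤ 1 → |ε * r| ≤ ε := fun r hr => by
    rw [abs_mul, abs_of_pos hε₀]
    exact mul_le_of_le_one_right hε₀.le hr
  have hfε : ∀ x, |ε * f x| ≤ ε := fun x => scale _ (hfb x)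
  have hgε : ∀ y, |ε * g y| ≤ ε := fun y => scale _ (hgb y)
  have hf₀ : ∫ x, ε * f x ∂P.fst = 0 := by
    rw [integral_const_mul, Measure.fst,
      integral_map measurable_fst.aemeasurable hf.aestronglyMeasurable, h₀, mul_zero]
  have hg₀ : ∫ y, ε * g y ∂P.snd = 0 := by
    have := h univ .univ
    rw [preimage_univ, Measure.restrict_univ, Measure.restrict_univ, h₀] at this
    rw [integral_const_mul, this, mul_zero]
  have hX : infoXZ P (coinKernel fun x => ε * f x)
      = mutualInfo (biasedCoin P.fst fun x => ε * f x) := by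
    rw [infoXZ, map_jointLaw_coinKernel P (hf.const_mul ε) (fun x => (hfε x).trans hε₁)
      measurable_fst (hf.const_mul ε) (fun x => (hfε x).trans hε₁)]
    · rfl
    · intro A hA
      exact setIntegral_map hA (hf.const_mul ε).aestronglyMeasurable measurable_fst.aemeasurable
  have hY : infoYZ P (coinKernel fun x => ε * f x)
      = mutualInfo (biasedCoin P.snd fun y => ε * g y) := by
    rw [infoYZ, map_jointLaw_coinKernel P (hf.const_mul ε) (fun x => (hfε x).trans hε₁)
      measurable_snd (hg.const_mul ε) (fun y => (hgε y).trans hε₁)]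
    · rfl
    · intro A hA
      rw [integral_const_mul, integral_const_mul, ← h A hA]
      rfl
  refine ⟨Bool, inferInstance, inferInstance, coinKernel fun x => ε * f x,
    isMarkovKernel_coinKernel (hf.const_mul ε) fun x => (hfε x).trans hε₁, ?_, ?_, ?_⟩
  · rw [hX, mutualInfo_biasedCoin _ (hf.const_mul ε) (fun x => (hfε x).trans hε₁) hf₀]
    exact ENNReal.ofReal_ne_top
  · rw [hY, mutualInfo_biasedCoin _ (hg.const_mul ε) (fun x => (hgε x).trans hε₁) hg₀]
    exact ENNReal.ofReal_ne_top
  · intro ν hν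
    rw [objective_const, objective, hX, hY]
    have b₁ := toReal_mutualInfo_biasedCoin_le P.fst (hf.const_mul ε) hε₁ hfε hf₀
    have b₂ := le_toReal_mutualInfo_biasedCoin P.snd (hg.const_mul ε)
      (fun y => (hgε y).trans hε₁) hg₀
    simp_rw [mul_pow, integral_const_mul, ← hV] at b₁
    simp_rw [mul_pow, integral_const_mul, ← hU] at b₂
    have b₃ := mul_le_mul_of_nonneg_left b₂ hβ
    have key : (1 + 2 * ε ^ 2) * V < β * U := by nlinarith
    have := mul_lt_mul_of_pos_left key (pow_pos hε₀ 2)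
    linarith

end Representation

/-! ### Densities on a countable label space. -/

section Label

variable {𝒴 : Type*} [MeasurableSpace 𝒴]

theorem measureReal_singleton_div_mem_unitInterval {ν Q : Measure 𝒴} [IsFiniteMeasure Q]
    (h : ν ≤ Q) (y : 𝒴) : 0 ≤ ν.real {y} / Q.real {y} ∧ ν.real {y} / Q.real {y} ≤ 1 :=
  ⟨by positivity, div_le_one_of_le₀ (ENNReal.toReal_mono (measure_ne_top _ _) (h _))
    measureReal_nonneg⟩

variable [DiscreteMeasurableSpace 𝒴] [Countable 𝒴]

theorem integrable_measureReal_singleton_div_pow {ν Q : Measure 𝒴} [IsFiniteMeasure Q]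
    (h : ν ≤ Q) (n : ℕ) : Integrable (fun y => (ν.real {y} / Q.real {y}) ^ n) Q := by
  refine Integrable.of_bound (measurable_of_countable _).aestronglyMeasurable 1
    (ae_of_all _ fun y => ?_)
  obtain ⟨h₀, h₁⟩ := measureReal_singleton_div_mem_unitInterval h y
  rw [Real.norm_of_nonneg (by positivity)]
  exact pow_le_one₀ h₀ h₁

theorem setIntegral_measureReal_singleton_div {ν Q : Measure 𝒴} [IsFiniteMeasure ν]
    [IsFiniteMeasure Q] (h : ν ≤ Q) (A : Set 𝒴) :
    ∫ y in A, ν.real {y} / Q.real {y} ∂Q = ν.real A := by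
  have hi := integrable_measureReal_singleton_div_pow h 1
  simp only [pow_one] at hi
  have e : ν.real A = ∫ _ in A, (1 : ℝ) ∂ν := by simp
  rw [e, setIntegral_countable _ A.to_countable hi.integrableOn,
    setIntegral_countable _ A.to_countable (integrable_const 1).integrableOn]
  refine tsum_congr fun y => ?_
  rw [smul_eq_mul, smul_eq_mul, mul_one]
  -- At a `Q`-null atom the quotient is `0` by convention; this loses nothing, since `ν ≤ Q` makes
  -- the atom `ν`-null too.
  rcases eq_or_ne (Q.real {(y : 𝒴)}) 0 with h₀ | h₀
  · rw [h₀, zero_mul]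
    refine le_antisymm measureReal_nonneg (h₀ ▸ ?_)
    exact ENNReal.toReal_mono (measure_ne_top _ _) (h _)
  · field_simp

theorem integral_measureReal_singleton_div_sq {ν Q : Measure 𝒴} [IsFiniteMeasure Q]
    (h : ν ≤ Q) :
    ∫ y, (ν.real {y} / Q.real {y}) ^ 2 ∂Q = ∑' y, ν.real {y} ^ 2 / Q.real {y} := by
  rw [integral_countable (integrable_measureReal_singleton_div_pow h 2)]
  refine tsum_congr fun y => ?_
  rw [smul_eq_mul]
  rcases eq_or_ne (Q.real {y}) 0 with h₀ | h₀
  · simp [h₀]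
  · field_simp

end Label

/-! ### Noise rates and the variance of the posterior class probability. -/

section NoiseRate

variable {Ω 𝒳 𝒞 𝒴 : Type*} [MeasurableSpace Ω]

theorem ae_mem_iff_of_disjoint {μ : Measure Ω} {X : Ω → 𝒳} {C : Ω → 𝒞} {S : 𝒞 → Set 𝒳}
    (hdisj : ∀ c d, c ≠ d → Disjoint (S c) (S d)) (hS : ∀ᵐ ω ∂μ, X ω ∈ S (C ω)) (c : 𝒞) :
    X ⁻¹' S c =ᵐ[μ] C ⁻¹' {c} := by
  filter_upwards [hS] with ω hω
  refine propext ⟨fun h => ?_, fun h => ?_⟩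
  · by_contra hne
    exact Set.disjoint_left.1 (hdisj _ _ hne) hω h
  · have h' : C ω = c := h
    exact h' ▸ hω

variable [MeasurableSpace 𝒴]

/-- The law of the label restricted to the event that the true class is `c`. -/
noncomputable def classLabelLaw (μ : Measure Ω) (C : Ω → 𝒞) (Y : Ω → 𝒴) (c : 𝒞) : Measure 𝒴 :=
  (μ.restrict (C ⁻¹' {c})).map Y

instance (μ : Measure Ω) [IsFiniteMeasure μ] (C : Ω → 𝒞) (Y : Ω → 𝒴) (c : 𝒞) :
    IsFiniteMeasure (classLabelLaw μ C Y c) := by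
  unfold classLabelLaw
  infer_instance

theorem classLabelLaw_le (μ : Measure Ω) (C : Ω → 𝒞) {Y : Ω → 𝒴} (hY : Measurable Y) (c : 𝒞) :
    classLabelLaw μ C Y c ≤ μ.map Y :=
  Measure.map_mono Measure.restrict_le_self hY

variable [DiscreteMeasurableSpace 𝒴]

theorem classLabelLaw_real_apply (μ : Measure Ω) (C : Ω → 𝒞) {Y : Ω → 𝒴} (hY : Measurable Y)
    (c : 𝒞) (A : Set 𝒴) :
    (classLabelLaw μ C Y c).real A = μ.real (Y ⁻¹' A ∩ C ⁻¹' {c}) := by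
  rw [classLabelLaw, map_measureReal_apply hY .of_discrete,
    measureReal_restrict_apply (hY .of_discrete)]

variable [MeasurableSpace 𝒞] [DiscreteMeasurableSpace 𝒞]

theorem noiseRate_eq (μ : Measure Ω) {C : Ω → 𝒞} (hC : Measurable C) {Y : Ω → 𝒴}
    (hY : Measurable Y) (c : 𝒞) (y : 𝒴) :
    noiseRate μ C Y c y = (classLabelLaw μ C Y c).real {y} / μ.real (C ⁻¹' {c}) := by
  rw [noiseRate, measureReal_def, cond_apply (hC .of_discrete), classLabelLaw_real_apply μ C hY,
    Set.inter_comm, div_eq_inv_mul, ENNReal.toReal_mul, ENNReal.toReal_inv, measureReal_def,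
    measureReal_def]

/-- The quotient is the posterior `P(Y* = c | Y = y)`, with mean `p` and, by Bayes' rule, second
moment `p² (chiSq + 1)`; the left side is its variance. -/
theorem integral_classLabelLaw_div_sub_sq [Countable 𝒴] (μ : Measure Ω) [IsProbabilityMeasure μ]
    {C : Ω → 𝒞} (hC : Measurable C) {Y : Ω → 𝒴} (hY : Measurable Y) {c : 𝒞}
    (hc : μ.real (C ⁻¹' {c}) ≠ 0) :
    ∫ y, ((classLabelLaw μ C Y c).real {y} / (μ.map Y).real {y} - μ.real (C ⁻¹' {c})) ^ 2
      ∂(μ.map Y) = μ.real (C ⁻¹' {c}) ^ 2 * chiSq μ C Y c := by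
  have hQ := Measure.isProbabilityMeasure_map (μ := μ) hY.aemeasurable
  have hle := classLabelLaw_le μ C hY c
  set ν := classLabelLaw μ C Y c with hν
  set Q := μ.map Y with hQdef
  set p := μ.real (C ⁻¹' {c}) with hp
  have h₁ : ∫ y, ν.real {y} / Q.real {y} ∂Q = p := by
    rw [← setIntegral_univ, setIntegral_measureReal_singleton_div hle, hν,
      classLabelLaw_real_apply μ C hY, Set.preimage_univ, Set.univ_inter]
  have h₂ : ∫ y, (ν.real {y} / Q.real {y}) ^ 2 ∂Q = p ^ 2 * (chiSq μ C Y c + 1) := by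
    rw [integral_measureReal_singleton_div_sq hle, chiSq, sub_add_cancel, ← tsum_mul_left]
    refine tsum_congr fun y => ?_
    rw [noiseRate_eq μ hC hY, ← map_measureReal_apply hY .of_discrete, ← hν, ← hQdef, ← hp]
    field_simp
  have i₁ : Integrable (fun y => 2 * p * (ν.real {y} / Q.real {y})) Q := by
    simpa only [pow_one] using (integrable_measureReal_singleton_div_pow hle 1).const_mul (2 * p)
  have i₂ := integrable_measureReal_singleton_div_pow hle 2
  have i₃ : Integrable (fun y => (ν.real {y} / Q.real {y}) ^ 2
      - 2 * p * (ν.real {y} / Q.real {y})) Q := i₂.sub i₁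
  have e : ∀ y, (ν.real {y} / Q.real {y} - p) ^ 2
      = (ν.real {y} / Q.real {y}) ^ 2 - 2 * p * (ν.real {y} / Q.real {y}) + p ^ 2 :=
    fun y => by ring
  simp_rw [e]
  rw [integral_add i₃ (integrable_const _), integral_sub i₂ i₁, integral_const_mul,
    h₁, h₂]
  simp only [integral_const, probReal_univ, smul_eq_mul]
  ring

end NoiseRate

end IB

/-! ### The learnability threshold. -/

theorem mainTheorem5 {Ω 𝒳 𝒞 𝒴 : Type*} [MeasurableSpace Ω] [MeasurableSpace 𝒳]
    [MeasurableSpace 𝒞] [DiscreteMeasurableSpace 𝒞] [Countable 𝒞]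
    [MeasurableSpace 𝒴] [DiscreteMeasurableSpace 𝒴] [Countable 𝒴] [Nonempty 𝒴]
    (μ : Measure Ω) [IsProbabilityMeasure μ]
    (X : Ω → 𝒳) (Ystar : Ω → 𝒞) (Y : Ω → 𝒴)
    (hX : Measurable X) (hYstar : Measurable Ystar) (hY : Measurable Y)
    (hsupp : IB.NoClassOverlap μ X Ystar)
    (hnoise : IB.ClassConditionalNoise μ X Ystar Y)
    (hdep : ¬ IndepFun X Y μ)
    (β : ℝ) (hβ : (⨅ c : 𝒞, IB.classRatio μ Ystar Y c) < (β : EReal)) :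
    IB.Learnable β (μ.map (fun ω => (X ω, Y ω))) := by
  obtain ⟨c, hc⟩ := iInf_lt_iff.1 hβ
  rw [IB.classRatio] at hc
  split_ifs at hc with hcase
  · exact absurd hc not_top_lt
  obtain ⟨hp₀, hD₀⟩ := not_or.1 hcase
  rw [EReal.coe_lt_coe_iff] at hc
  obtain ⟨S, hS, hdisj, hae⟩ := hsupp
  have hSc := IB.ae_mem_iff_of_disjoint hdisj hae c
  have hvarY := IB.integral_classLabelLaw_div_sub_sq μ hYstar hY hp₀
  have hle := IB.classLabelLaw_le μ Ystar hY c
  have hXY : Measurable fun ω => (X ω, Y ω) := hX.prodMk hY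
  have hP := Measure.isProbabilityMeasure_map (μ := μ) hXY.aemeasurable
  have hQ := Measure.isProbabilityMeasure_map (μ := μ) hY.aemeasurable
  have hfst : (μ.map fun ω => (X ω, Y ω)).fst = μ.map X := Measure.fst_map_prodMk hY
  have hsnd : (μ.map fun ω => (X ω, Y ω)).snd = μ.map Y := Measure.snd_map_prodMk hX
  set p := μ.real (Ystar ⁻¹' {c}) with hp
  set D := IB.chiSq μ Ystar Y c with hD
  have hp_nonneg : 0 ≤ p := measureReal_nonneg
  have hp_pos : 0 < p := lt_of_le_of_ne hp_nonneg (Ne.symm hp₀)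
  have hp_le : p ≤ 1 := measureReal_le_one
  -- `p² D` is a variance, hence nonnegative, and `D ≠ 0` in this branch of `classRatio`.
  have hD_pos : 0 < D := by
    refine lt_of_le_of_ne (nonneg_of_mul_nonneg_right ?_ (pow_pos hp_pos 2)) (Ne.symm hD₀)
    exact hvarY ▸ integral_nonneg fun y => sq_nonneg _
  have hinv : 0 ≤ 1 / p - 1 := sub_nonneg.2 ((one_le_div hp_pos).2 hp_le)
  have hfmeas : Measurable fun x => (S c).indicator (fun _ => (1 : ℝ)) x - p :=
    (measurable_const.indicator (hS c)).sub_const p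
  have hfmeas' : Measurable fun q : 𝒳 × 𝒴 => (S c).indicator (fun _ => (1 : ℝ)) q.1 - p :=
    hfmeas.comp measurable_fst
  have hind : ∀ B, ∫ ω in B, (S c).indicator (fun _ => (1 : ℝ)) (X ω) ∂μ
      = μ.real (Ystar ⁻¹' {c} ∩ B) := by
    intro B
    have e : (fun ω => (S c).indicator (fun _ => (1 : ℝ)) (X ω))
        = (X ⁻¹' S c).indicator fun _ => 1 := rfl
    rw [e, integral_indicator_const _ (hX (hS c)), smul_eq_mul, mul_one,
      measureReal_restrict_apply (hX (hS c))]
    -- Non-overlap enters here: up to a null set, the input reveals whether the true class is `c`.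
    exact measureReal_congr (hSc.inter (ae_eq_refl B))
  have hindint : Integrable (fun ω => (S c).indicator (fun _ => (1 : ℝ)) (X ω)) μ :=
    (integrable_const (1 : ℝ)).indicator (hX (hS c))
  have hset : ∀ B, ∫ ω in B, ((S c).indicator (fun _ => (1 : ℝ)) (X ω) - p) ∂μ
      = μ.real (Ystar ⁻¹' {c} ∩ B) - p * μ.real B := by
    intro B
    rw [integral_sub hindint.integrableOn (integrable_const _), hind B]
    simp [mul_comm]
  refine IB.learnable_of_variance_lt _ ((div_nonneg hinv hD_pos.le).trans hc.le) hfmeas ?_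
    (g := fun y => (IB.classLabelLaw μ Ystar Y c).real {y} / (μ.map Y).real {y} - p)
    (measurable_of_countable _) ?_ ?_ ?_ ?_
  · intro x
    by_cases hx : x ∈ S c <;> simp only [hx, Set.indicator_of_mem, Set.indicator_of_notMem,
      not_false_eq_true] <;> rw [abs_le] <;> constructor <;> linarith
  · intro y
    obtain ⟨h₀, h₁⟩ := IB.measureReal_singleton_div_mem_unitInterval hle y
    rw [abs_le]
    constructor <;> linarith
  · rw [integral_map hXY.aemeasurable hfmeas'.aestronglyMeasurable,
      ← setIntegral_univ, hset]
    simp [hp]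
  · intro A hA
    have hr := IB.integrable_measureReal_singleton_div_pow hle 1
    simp only [pow_one] at hr
    rw [hsnd, integral_sub hr.integrableOn (integrable_const _),
      IB.setIntegral_measureReal_singleton_div hle, IB.classLabelLaw_real_apply μ Ystar hY,
      setIntegral_map (measurable_snd hA) hfmeas'.aestronglyMeasurable
        hXY.aemeasurable]
    have e : (fun ω => (X ω, Y ω)) ⁻¹' (Prod.snd ⁻¹' A) = Y ⁻¹' A := rfl
    rw [e, hset, Set.inter_comm, integral_const, measureReal_restrict_apply .univ,
      Set.univ_inter, map_measureReal_apply hY hA, smul_eq_mul, mul_comm p]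
  -- An indicator is its own square, so its centred square is affine in it.
  · have e : ∀ x, ((S c).indicator (fun _ => (1 : ℝ)) x - p) ^ 2
        = (1 - 2 * p) * (S c).indicator (fun _ => (1 : ℝ)) x + p ^ 2 := by
      intro x
      by_cases hx : x ∈ S c
      · simp only [hx, Set.indicator_of_mem]
        ring
      · simp [hx]
    have hvarX : ∫ x, ((S c).indicator (fun _ => (1 : ℝ)) x - p) ^ 2 ∂μ.map X = p * (1 - p) := by
      rw [integral_map hX.aemeasurable (hfmeas.pow_const 2).aestronglyMeasurable]
      simp_rw [e]
      rw [integral_add (hindint.const_mul _) (integrable_const _), integral_const_mul,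
        ← setIntegral_univ, hind, Set.inter_univ, ← hp, integral_const]
      simp only [probReal_univ, smul_eq_mul]
      ring
    rw [hfst, hsnd, hvarX, hvarY]
    rw [div_lt_iff₀ hD_pos] at hc
    have := mul_lt_mul_of_pos_left hc (pow_pos hp_pos 2)
    -- Multiplying `1/p - 1 < β D` by `p²` turns its two sides into `Var f(X)` and `β Var g(Y)`.
    have e₂ : p ^ 2 * (1 / p - 1) = p * (1 - p) := by
      field_simp
    linarith
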